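/- Let $I\subseteq\mathbb{R}$ be a nonempty open interval. For $n\ge 1$, a pair $(f,g)$ of functions $I\to\mathbb{R}$ is said to be in the class $\mathcal{C}_n(I)$ if $f,g$ are $n$ times continuously differentiable, $f(x)g(y)-f(y)g(x)\neq0$ for all distinct $x,y\in I$, and $f'(x)g(x)-f(x)g'(x)\ne0$ for all $x\in I$. Two pairs $(f,g)$ and $(h,k)$ are called equivalent if there are real constants $\alpha,\beta,\gamma,\delta$ with $\alpha\delta-\beta\gamma\neq0$ such that $f=\alpha h+\beta k$ and $g=\gamma h+\delta k$ on $I$. Let $(f,g),(h,k)\in\mathcal{C}_3(I)$ be such that $g$ and $k$ do not vanish on $I$. Let $\mu$ be a Borel probability measure on $[0,1]$, let $\hat\mu_1=\int_{[0,1]}t\,d\mu(t)$ and $\mu_n=\int_{[0,1]}(t-\hat\mu_1)^n\,d\mu(t)$, and assume that $\mu_2\neq0$ and $\mu_3\neq0$. Consider, for $(x,y)\in I^2$, the equality $$\left(\frac{f}{g}\right)^{-1}\left(\frac{\int_{[0,1]} f(tx+(1-t)y)\,d\mu(t)}{\int_{[0,1]} g(tx+(1-t)y)\,d\mu(t)}\right)=\left(\frac{h}{k}\right)^{-1}\left(\frac{\int_{[0,1]}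 h(tx+(1-t)y)\,d\mu(t)}{\int_{[0,1]} k(tx+(1-t)y)\,d\mu(t)}\right),\qquad(*)$$ where $(f/g)^{-1}$ and $(h/k)^{-1}$ denote the inverses of the injective functions $f/g$ and $h/k$ on $I$. Then the following assertions are equivalent: (i) $(*)$ holds for all $(x,y)\in I^2$; (ii) there exist a dense subset $D\subseteq I$ and an open set $U\subseteq I^2$ containing $\{(x,x)\mid x\in D\}$ such that $(*)$ holds for all $(x,y)\in U$; (iii) the pairs $(f,g)$ and $(h,k)$ are equivalent. -/

import Mathlib

open MeasureTheory ProbabilityTheory Set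

/-- The pair `(f, g)` of continuous functions is a two-dimensional Chebyshev system on `I`: the
determinant `f x * g y - f y * g x` is nonzero for all distinct `x, y` in `I`. -/
structure IsChebyshevSystem (I : Set ℝ) (f g : ℝ → ℝ) : Prop where
  continuousOn_left : ContinuousOn f I
  continuousOn_right : ContinuousOn g I
  det_ne_zero : ∀ x ∈ I, ∀ y ∈ I, x ≠ y → f x * g y - f y * g x ≠ 0

/-- The regularity class `C_n(I)` of pairs of functions on an open interval `I`: Chebyshev systems
of `n`-times continuously differentiable functions whose Wronski determinant, if `n ≥ 1`, does not
vanish on `I`. Only the values of the functions on `I` matter. -/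
structure MemClassC (n : ℕ) (I : Set ℝ) (f g : ℝ → ℝ) : Prop where
  contDiffOn_left : ContDiffOn ℝ n f I
  contDiffOn_right : ContDiffOn ℝ n g I
  chebyshev : IsChebyshevSystem I f g
  wronskian_ne_zero : 1 ≤ n → ∀ x ∈ I, deriv f x * g x - f x * deriv g x ≠ 0

/-- The pairs `(f, g)` and `(h, k)` are equivalent on `I`: each component of the first pair is a
linear combination of the second pair, with a nonsingular coefficient matrix. -/
def EquivalentPairs (I : Set ℝ) (f g h k : ℝ → ℝ) : Prop :=
  ∃ α β γ δ : ℝ, α * δ - β * γ ≠ 0 ∧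
    ∀ x ∈ I, f x = α * h x + β * k x ∧ g x = γ * h x + δ * k x

/-- The two-variable mean
`(f/g)⁻¹ (∫ f (t x + (1 - t) y) dμ(t) / ∫ g (t x + (1 - t) y) dμ(t))`, where `(f/g)⁻¹` is the
inverse of the function `f/g` restricted to `I`. See `bajraktarevicMean_spec`: the inverse is
applied inside its domain. -/
noncomputable def bajraktarevicMean (I : Set ℝ) (f g : ℝ → ℝ) (μ : Measure unitInterval)
    (x y : ℝ) : ℝ :=
  Function.invFunOn (fun z => f z / g z) I
    ((∫ t : unitInterval, f ((t : ℝ) * x + (1 - (t : ℝ)) * y) ∂μ) /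
      (∫ t : unitInterval, g ((t : ℝ) * x + (1 - (t : ℝ)) * y) ∂μ))

theorem exists_zero_of_integral_eq_zero (μ : Measure unitInterval) [IsProbabilityMeasure μ]
    (φ : unitInterval → ℝ) (hφ : Continuous φ) (h0 : ∫ t, φ t ∂μ = 0) : ∃ t, φ t = 0 := by
  have hint : Integrable φ μ := hφ.integrable_of_hasCompactSupport (HasCompactSupport.of_compactSpace φ)
  obtain ⟨t, ht⟩ := exists_le_integral hint
  obtain ⟨s, hs⟩ := exists_integral_le hint
  exact mem_range_of_exists_le_of_exists_ge hφ ⟨t, h0 ▸ ht⟩ ⟨s, h0 ▸ hs⟩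

/-- If `f/g` is injective on `I`, then the value of the mean is the unique `z` in `I` at which `f/g`
equals the quotient of the two integrals, and the denominator does not vanish. -/
theorem bajraktarevicMean_spec {I : Set ℝ} (hI : I.OrdConnected) {f g : ℝ → ℝ}
    (hfg : IsChebyshevSystem I f g) (hg : ∀ x ∈ I, g x ≠ 0)
    (μ : Measure unitInterval) [IsProbabilityMeasure μ] {x y : ℝ} (hx : x ∈ I) (hy : y ∈ I) :
    Set.InjOn (fun z => f z / g z) I ∧ bajraktarevicMean I f g μ x y ∈ I ∧
    (∫ t : unitInterval, g ((t : ℝ) * x + (1 - (t : ℝ)) * y) ∂μ) ≠ 0 ∧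
    f (bajraktarevicMean I f g μ x y) / g (bajraktarevicMean I f g μ x y) =
      (∫ t : unitInterval, f ((t : ℝ) * x + (1 - (t : ℝ)) * y) ∂μ) /
        (∫ t : unitInterval, g ((t : ℝ) * x + (1 - (t : ℝ)) * y) ∂μ) := by
  have hm : ∀ t : unitInterval, (t : ℝ) * x + (1 - (t : ℝ)) * y ∈ I := fun t =>
    hI.convex hx hy t.2.1 (sub_nonneg.2 t.2.2) (by ring)
  have hc : Continuous fun t : unitInterval => (t : ℝ) * x + (1 - (t : ℝ)) * y := by fun_prop
  have hcf := hfg.continuousOn_left.comp_continuous hc hm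
  have hcg := hfg.continuousOn_right.comp_continuous hc hm
  have hG : (∫ t : unitInterval, g ((t : ℝ) * x + (1 - (t : ℝ)) * y) ∂μ) ≠ 0 := fun h0 => by
    obtain ⟨t, ht⟩ := exists_zero_of_integral_eq_zero μ _ hcg h0
    exact hg _ (hm t) ht
  have hex : ∃ z ∈ I, f z / g z =
      (∫ t : unitInterval, f ((t : ℝ) * x + (1 - (t : ℝ)) * y) ∂μ) /
        (∫ t : unitInterval, g ((t : ℝ) * x + (1 - (t : ℝ)) * y) ∂μ) := by
    set F := ∫ t : unitInterval, f ((t : ℝ) * x + (1 - (t : ℝ)) * y) ∂μ with hF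
    set G := ∫ t : unitInterval, g ((t : ℝ) * x + (1 - (t : ℝ)) * y) ∂μ with hG'
    have hif := hcf.integrable_of_hasCompactSupport (μ := μ) (HasCompactSupport.of_compactSpace _)
    have hig := hcg.integrable_of_hasCompactSupport (μ := μ) (HasCompactSupport.of_compactSpace _)
    obtain ⟨t, ht⟩ := exists_zero_of_integral_eq_zero μ _
      (hcf.sub (hcg.const_smul (F / G))) (by
        refine (integral_sub hif (hig.smul (F / G))).trans ?_
        have h2 : ∫ t, ((F / G) • (g ∘ fun t : unitInterval => (t : ℝ) * x + (1 - (t : ℝ)) * y)) t ∂μ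
            = (F / G) • G :=
          integral_smul (F / G) (fun t : unitInterval => g ((t : ℝ) * x + (1 - (t : ℝ)) * y))
        rw [h2, smul_eq_mul, div_mul_cancel₀ _ hG]
        exact sub_self F)
    refine ⟨_, hm t, ?_⟩
    rw [div_eq_iff (hg _ (hm t))]
    simpa [sub_eq_zero] using ht
  refine ⟨fun a ha b hb hab => ?_, Function.invFunOn_mem hex, hG, Function.invFunOn_eq hex⟩
  by_contra hne
  refine hfg.det_ne_zero a ha b hb hne ?_
  have := (div_eq_div_iff (hg a ha) (hg b hb)).1 hab
  linarith

open Filter Topology Asymptotics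

/-! Write `W_ij = f⁽ⁱ⁾ g⁽ʲ⁾ - f⁽ʲ⁾ g⁽ⁱ⁾`, and let `m` be the mean of `μ`. Along `x = p + (1 - m) s`,
`y = p - m s` the mean expands as `p + (μ₂/2)(W₂₀/W₁₀)(p) s² + (μ₃/6)(W₃₀/W₁₀)(p) s³ + o(s³)`
(`bajraktarevicMean_sub_isLittleO`). Since `μ₂, μ₃ ≠ 0`, equality of the means near `(p, p)` makes
`W₂₀/W₁₀` and `W₃₀/W₁₀` agree at `p` for both pairs; density and continuity extend this to `I`.

Differentiating `W₂₀/W₁₀` shows that `W₂₁/W₁₀` agrees too. Hence `f, g, h, k` all solve one equation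
`u'' = Φ u' + Ψ u`, whose solution space is two-dimensional, so the pairs are equivalent.
Conversely, an equivalence acts on `f/g` and on the quotient of integrals by the same Möbius map,
which leaves the mean unchanged. -/

/-! ### Taylor expansion of the integrals -/

theorem ContDiffOn.taylor_three_isLittleO {I : Set ℝ} (hI : IsOpen I) (hc : Convex ℝ I) {f : ℝ → ℝ}
    (hf : ContDiffOn ℝ 3 f I) {p : ℝ} (hp : p ∈ I) :
    (fun u => f (p + u) - (f p + deriv f p * u + deriv (deriv f) p / 2 * u ^ 2 +
      deriv (deriv (deriv f)) p / 6 * u ^ 3)) =o[𝓝 0] fun u : ℝ => u ^ 3 := by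
  have h := taylor_isLittleO (n := 3) hc hp hf
  rw [hI.nhdsWithin_eq hp] at h
  have ht : Tendsto (fun u : ℝ => p + u) (𝓝 0) (𝓝 p) := by
    have : Continuous fun u : ℝ => p + u := by fun_prop
    simpa using this.tendsto 0
  refine (h.comp_tendsto ht).congr (fun u => ?_) fun u => by simp
  have hd : ∀ n, iteratedDerivWithin n f I p = deriv^[n] f p := fun n => by
    rw [iteratedDerivWithin_of_isOpen hI hp, iteratedDeriv_eq_iterate]
  simp only [Function.comp_apply, taylorWithinEval_succ, taylor_within_zero_eval, hd, zero_add,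
    Function.iterate_succ, Function.iterate_zero, id, add_sub_cancel_left, smul_eq_mul]
  norm_num [Nat.factorial]
  ring

/-- Because `|τ| ≤ 1`, the bound `|R (τ t * s)| ≤ c |s|ⁿ` is uniform in `t`, so it survives
integration against a probability measure. -/
theorem isLittleO_integral_comp_mul {Ω : Type*} [MeasurableSpace Ω] (μ : Measure Ω)
    [IsProbabilityMeasure μ] {R : ℝ → ℝ} {n : ℕ} (hR : R =o[𝓝 0] fun u : ℝ => u ^ n) {τ : Ω → ℝ}
    (hτ : ∀ t, |τ t| ≤ 1) : (fun s => ∫ t, R (τ t * s) ∂μ) =o[𝓝 0] fun s : ℝ => s ^ n := by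
  rw [isLittleO_iff] at hR ⊢
  intro c hc
  obtain ⟨ε, hε, h⟩ := Metric.eventually_nhds_iff.1 (hR hc)
  refine Metric.eventually_nhds_iff.2 ⟨ε, hε, fun s hs => ?_⟩
  have hle : ∀ t, |τ t * s| ≤ |s| := fun t => by
    rw [abs_mul]; exact mul_le_of_le_one_left (abs_nonneg _) (hτ t)
  refine (norm_integral_le_of_norm_le_const (C := c * ‖s ^ n‖) (.of_forall fun t => ?_)).trans
    (by simp)
  have hs' : |s| < ε := by simpa [Real.dist_eq] using hs
  refine (h (y := τ t * s) (by simpa [Real.dist_eq] using (hle t).trans_lt hs')).trans ?_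
  rw [norm_pow, norm_pow]
  gcongr
  exact hle t

theorem abs_coe_sub_integral_le (μ : Measure unitInterval) [IsProbabilityMeasure μ]
    (t : unitInterval) : |(t : ℝ) - ∫ r : unitInterval, (r : ℝ) ∂μ| ≤ 1 := by
  have hc : Continuous fun r : unitInterval => (r : ℝ) := by fun_prop
  have hint : Integrable (fun r : unitInterval => (r : ℝ)) μ :=
    hc.integrable_of_hasCompactSupport (HasCompactSupport.of_compactSpace _)
  obtain ⟨a, ha⟩ := exists_le_integral hint
  obtain ⟨b, hb⟩ := exists_integral_le hint
  have := a.2.1; have := b.2.2; have := t.2.1; have := t.2.2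
  rw [abs_le]
  constructor <;> linarith

/-- Centring at the mean `m` makes the linear Taylor term integrate to zero; the next two terms
produce the central moments. -/
theorem isLittleO_integral_sub_moments {I : Set ℝ} (hI : IsOpen I) (hc : Convex ℝ I) {f : ℝ → ℝ}
    (hf : ContDiffOn ℝ 3 f I) {p : ℝ} (hp : p ∈ I) (μ : Measure unitInterval)
    [IsProbabilityMeasure μ] {m : ℝ} (hm : m = ∫ r : unitInterval, (r : ℝ) ∂μ) :
    (fun s => (∫ t : unitInterval, f (p + ((t : ℝ) - m) * s) ∂μ) - (f p +
      centralMoment (fun t : unitInterval => (t : ℝ)) 2 μ * (deriv (deriv f) p / 2) * s ^ 2 +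
      centralMoment (fun t : unitInterval => (t : ℝ)) 3 μ * (deriv (deriv (deriv f)) p / 6)
        * s ^ 3)) =o[𝓝 0] fun s : ℝ => s ^ 3 := by
  have hτ : ∀ t : unitInterval, |(t : ℝ) - m| ≤ 1 := fun t => hm ▸ abs_coe_sub_integral_le μ t
  have hR := isLittleO_integral_comp_mul μ (hf.taylor_three_isLittleO hI hc hp) hτ
  refine hR.congr' ?_ .rfl
  obtain ⟨ε, hε, hball⟩ := Metric.isOpen_iff.1 hI p hp
  filter_upwards [Metric.ball_mem_nhds (0 : ℝ) hε] with s hs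
  have hmem : ∀ t : unitInterval, p + ((t : ℝ) - m) * s ∈ I := fun t => hball <| by
    have hs' : |s| < ε := by simpa using hs
    rw [Metric.mem_ball, Real.dist_eq, add_sub_cancel_left, abs_mul]
    exact (mul_le_of_le_one_left (abs_nonneg _) (hτ t)).trans_lt hs'
  have hint : ∀ φ : unitInterval → ℝ, Continuous φ → Integrable φ μ := fun φ hφ =>
    hφ.integrable_of_hasCompactSupport (HasCompactSupport.of_compactSpace _)
  have hcf : Continuous fun t : unitInterval => f (p + ((t : ℝ) - m) * s) :=
    hf.continuousOn.comp_continuous (by fun_prop) hmem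
  have h1 : ∫ t : unitInterval, ((t : ℝ) - m) ∂μ = 0 := by
    rw [integral_sub (hint _ (by fun_prop)) (integrable_const _)]
    simp [hm]
  have h2 : centralMoment (fun t : unitInterval => (t : ℝ)) 2 μ
      = ∫ t : unitInterval, ((t : ℝ) - m) ^ 2 ∂μ := by simp [centralMoment, hm]
  have h3 : centralMoment (fun t : unitInterval => (t : ℝ)) 3 μ
      = ∫ t : unitInterval, ((t : ℝ) - m) ^ 3 ∂μ := by simp [centralMoment, hm]
  rw [integral_sub (hint _ hcf) (hint _ (by fun_prop)),
    integral_add (hint _ (by fun_prop)) (hint _ (by fun_prop)),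
    integral_add (hint _ (by fun_prop)) (hint _ (by fun_prop)),
    integral_add (hint _ (by fun_prop)) (hint _ (by fun_prop)), h2, h3]
  simp only [mul_pow, integral_const_mul, integral_mul_const, h1, integral_const, probReal_univ,
    one_smul]
  ring

/-! ### Expansion of the mean near the diagonal -/

/-- If `z` solves `f z * G s = g z * F s` near `p` and `F`, `G` are third order perturbations of
`f p`, `g p` without linear term, then `z` has the corresponding third order expansion. -/
theorem isLittleO_implicit_sub {f g F G z : ℝ → ℝ} {p f₀ g₀ f₁ g₁ a b c d : ℝ}
    (hf : (fun u => f (p + u) - (f₀ + f₁ * u)) =O[𝓝 0] fun u : ℝ => u ^ 2)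
    (hg : (fun u => g (p + u) - (g₀ + g₁ * u)) =O[𝓝 0] fun u : ℝ => u ^ 2)
    (hW : f₁ * g₀ - f₀ * g₁ ≠ 0)
    (hF : (fun s => F s - (f₀ + a * s ^ 2 + b * s ^ 3)) =o[𝓝 0] fun s : ℝ => s ^ 3)
    (hG : (fun s => G s - (g₀ + c * s ^ 2 + d * s ^ 3)) =o[𝓝 0] fun s : ℝ => s ^ 3)
    (hz : Tendsto z (𝓝 0) (𝓝 p)) (hzFG : ∀ᶠ s in 𝓝 0, f (z s) * G s = g (z s) * F s) :
    (fun s => z s - p - ((a * g₀ - f₀ * c) / (f₁ * g₀ - f₀ * g₁) * s ^ 2 +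
      (b * g₀ - f₀ * d) / (f₁ * g₀ - f₀ * g₁) * s ^ 3)) =o[𝓝 0] fun s : ℝ => s ^ 3 := by
  set W := f₁ * g₀ - f₀ * g₁ with hWdef
  have hw0 : Tendsto (fun s => z s - p) (𝓝 0) (𝓝 0) := by simpa using hz.sub_const p
  have hfz : (fun s => f (z s) - (f₀ + f₁ * (z s - p))) =O[𝓝 0] fun s => (z s - p) ^ 2 := by
    simpa [Function.comp_def] using hf.comp_tendsto hw0
  have hgz : (fun s => g (z s) - (g₀ + g₁ * (z s - p))) =O[𝓝 0] fun s => (z s - p) ^ 2 := by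
    simpa [Function.comp_def] using hg.comp_tendsto hw0
  have hww : (fun s => (z s - p) ^ 2) =o[𝓝 0] fun s => z s - p := by
    simpa [Function.comp_def] using
      (isLittleO_pow_id (𝕜 := ℝ) (n := 2) (by norm_num)).comp_tendsto hw0
  have h32 : (fun s : ℝ => s ^ 3) =O[𝓝 0] fun s : ℝ => s ^ 2 :=
    (isLittleO_pow_pow (by norm_num : 2 < 3)).isBigO
  have hs2 : (fun s : ℝ => s ^ 2) =O[𝓝 0] fun s : ℝ => s ^ 2 := isBigO_refl _ _
  have hF2 : (fun s => F s - f₀) =O[𝓝 0] fun s : ℝ => s ^ 2 :=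
    (((hF.isBigO.trans h32).add (hs2.const_mul_left a)).add (h32.const_mul_left b)).congr_left
      fun s => by ring
  have hG2 : (fun s => G s - g₀) =O[𝓝 0] fun s : ℝ => s ^ 2 :=
    (((hG.isBigO.trans h32).add (hs2.const_mul_left c)).add (h32.const_mul_left d)).congr_left
      fun s => by ring
  have hf1 : (fun s => f (z s) - f₀) =O[𝓝 0] fun s => z s - p :=
    ((hfz.trans hww.isBigO).add ((isBigO_refl _ _).const_mul_left f₁)).congr_left
      fun s => by ring
  have hg1 : (fun s => g (z s) - g₀) =O[𝓝 0] fun s => z s - p :=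
    ((hgz.trans hww.isBigO).add ((isBigO_refl _ _).const_mul_left g₁)).congr_left
      fun s => by ring
  have hw1 : (fun s => z s - p) =O[𝓝 0] fun _ => (1 : ℝ) := hw0.isBigO_one ℝ
  have hfb : (fun s => f (z s)) =O[𝓝 0] fun _ => (1 : ℝ) :=
    ((hf1.trans hw1).add (isBigO_const_const f₀ one_ne_zero _)).congr_left fun s => by ring
  have hgb : (fun s => g (z s)) =O[𝓝 0] fun _ => (1 : ℝ) :=
    ((hg1.trans hw1).add (isBigO_const_const g₀ one_ne_zero _)).congr_left fun s => by ring
  have hlin : (fun s => W * (z s - p) - (f (z s) * g₀ - g (z s) * f₀)) =O[𝓝 0]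
      fun s => (z s - p) ^ 2 :=
    ((hgz.const_mul_left f₀).sub (hfz.const_mul_left g₀)).congr_left fun s => by
      rw [hWdef]; ring
  have hdet : ∀ᶠ s in 𝓝 0, g (z s) * (F s - f₀) - f (z s) * (G s - g₀) =
      f (z s) * g₀ - g (z s) * f₀ := by
    filter_upwards [hzFG] with s hs
    linear_combination -hs
  have hdet2 : (fun s => f (z s) * g₀ - g (z s) * f₀) =O[𝓝 0] fun s : ℝ => s ^ 2 := by
    refine IsBigO.congr' ?_ hdet .rfl
    simpa using (hgb.mul hF2).sub (hfb.mul hG2)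
  -- Bootstrap: the error in `hlin` is quadratic in `z - p → 0`, so it is absorbed by `W * (z - p)`.
  -- Once `z - p = O(s²)` is known, every quadratic error is `O(s⁴)`.
  have hw2 : (fun s => z s - p) =O[𝓝 0] fun s : ℝ => s ^ 2 := by
    have h1 : (fun s => W * (z s - p)) =O[𝓝 0] fun s => f (z s) * g₀ - g (z s) * f₀ := by
      have h2 : (fun s => W * (z s - p) - (f (z s) * g₀ - g (z s) * f₀)) =o[𝓝 0]
          fun s => W * (z s - p) :=
        (hlin.trans_isLittleO hww).trans_isBigO ((isBigO_refl _ _).const_mul_right hW)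
      exact h2.right_isBigO_sub.congr_right fun s => by ring
    exact (isBigO_const_mul_left_iff hW).1 (h1.trans hdet2)
  have h43 : (fun s : ℝ => s ^ 2 * s ^ 2) =o[𝓝 0] fun s : ℝ => s ^ 3 := by
    simpa [← pow_add] using isLittleO_pow_pow (𝕜 := ℝ) (by norm_num : 3 < 4)
  have hlin3 := (hlin.trans (by simpa [pow_two] using hw2.mul hw2)).trans_isLittleO h43
  have hA := ((hg1.trans hw2).mul hF2).trans_isLittleO h43
  have hB := ((hf1.trans hw2).mul hG2).trans_isLittleO h43
  have hsum := (((hlin3.add hA).sub hB).add (hF.const_mul_left g₀)).sub (hG.const_mul_left f₀)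
  refine (hsum.const_mul_left W⁻¹).congr' ?_ .rfl
  filter_upwards [hdet] with s hs
  field_simp
  linear_combination hs

theorem eq_zero_of_isLittleO_cube {a b : ℝ}
    (h : (fun s : ℝ => a * s ^ 2 + b * s ^ 3) =o[𝓝 0] fun s : ℝ => s ^ 3) : a = 0 ∧ b = 0 := by
  have key : ∀ (n : ℕ) (c : ℝ), ((fun s : ℝ => c * s ^ n) =o[𝓝 0] fun s : ℝ => s ^ n) → c = 0 := by
    intro n c hc
    by_contra hne
    refine isLittleO_irrefl ?_ ((isLittleO_const_mul_left_iff hne).1 hc)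
    have hev : ∀ᶠ s : ℝ in 𝓝[≠] 0, s ^ n ≠ 0 :=
      eventually_mem_nhdsWithin.mono fun s hs => pow_ne_zero n hs
    exact (Eventually.frequently (hev.mono fun s hs => by simpa using hs)).filter_mono nhdsWithin_le_nhds
  have h32 : (fun s : ℝ => s ^ 3) =o[𝓝 0] fun s : ℝ => s ^ 2 :=
    isLittleO_pow_pow (by norm_num : 2 < 3)
  have ha : a = 0 := key 2 a <|
    ((h.trans h32).sub (h32.const_mul_left b)).congr_left fun s => by ring
  subst ha
  exact ⟨rfl, key 3 b (by simpa using h)⟩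

theorem IsChebyshevSystem.mono {I J : Set ℝ} {f g : ℝ → ℝ} (h : IsChebyshevSystem I f g)
    (hJ : J ⊆ I) : IsChebyshevSystem J f g :=
  ⟨h.continuousOn_left.mono hJ, h.continuousOn_right.mono hJ,
    fun x hx y hy => h.det_ne_zero x (hJ hx) y (hJ hy)⟩

/-- The integrals only see the segment, so the mean formed on `uIcc x y` solves the same equation;
injectivity of `f/g` on `I` identifies the two. -/
theorem bajraktarevicMean_mem_uIcc {I : Set ℝ} (hI : I.OrdConnected) {f g : ℝ → ℝ}
    (hfg : IsChebyshevSystem I f g) (hg : ∀ x ∈ I, g x ≠ 0)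
    (μ : Measure unitInterval) [IsProbabilityMeasure μ] {x y : ℝ} (hx : x ∈ I) (hy : y ∈ I) :
    bajraktarevicMean I f g μ x y ∈ uIcc x y := by
  have hsub : uIcc x y ⊆ I := hI.uIcc_subset hx hy
  obtain ⟨hinj, hmem, -, heq⟩ := bajraktarevicMean_spec hI hfg hg μ hx hy
  obtain ⟨-, hmem', -, heq'⟩ := bajraktarevicMean_spec ordConnected_uIcc (hfg.mono hsub)
    (fun z hz => hg z (hsub hz)) μ left_mem_uIcc right_mem_uIcc
  rwa [hinj hmem (hsub hmem') (heq.trans heq'.symm)]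

theorem ContDiffOn.taylor_one_isBigO {I : Set ℝ} (hI : IsOpen I) (hc : Convex ℝ I) {f : ℝ → ℝ}
    (hf : ContDiffOn ℝ 3 f I) {p : ℝ} (hp : p ∈ I) :
    (fun u => f (p + u) - (f p + deriv f p * u)) =O[𝓝 0] fun u : ℝ => u ^ 2 := by
  have h32 : (fun s : ℝ => s ^ 3) =O[𝓝 0] fun s : ℝ => s ^ 2 :=
    (isLittleO_pow_pow (by norm_num : 2 < 3)).isBigO
  exact ((((hf.taylor_three_isLittleO hI hc hp).isBigO.trans h32).add
    ((isBigO_refl _ _).const_mul_left (deriv (deriv f) p / 2))).add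
    (h32.const_mul_left (deriv (deriv (deriv f)) p / 6))).congr_left fun s => by ring

theorem bajraktarevicMean_sub_isLittleO {I : Set ℝ} (hI : IsOpen I) (hIc : I.OrdConnected)
    {f g : ℝ → ℝ} (hfg : MemClassC 3 I f g) (hg : ∀ x ∈ I, g x ≠ 0) (μ : Measure unitInterval)
    [IsProbabilityMeasure μ] {p : ℝ} (hp : p ∈ I) {m : ℝ}
    (hm : m = ∫ r : unitInterval, (r : ℝ) ∂μ) :
    (fun s => bajraktarevicMean I f g μ (p + (1 - m) * s) (p - m * s) - p -
      (centralMoment (fun t : unitInterval => (t : ℝ)) 2 μ / 2 *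
        ((deriv (deriv f) p * g p - f p * deriv (deriv g) p) /
          (deriv f p * g p - f p * deriv g p)) * s ^ 2 +
      centralMoment (fun t : unitInterval => (t : ℝ)) 3 μ / 6 *
        ((deriv (deriv (deriv f)) p * g p - f p * deriv (deriv (deriv g)) p) /
          (deriv f p * g p - f p * deriv g p)) * s ^ 3)) =o[𝓝 0] fun s : ℝ => s ^ 3 := by
  have hc : Convex ℝ I := hIc.convex
  have hf3 := hfg.contDiffOn_left
  have hg3 := hfg.contDiffOn_right
  have hx : Tendsto (fun s : ℝ => p + (1 - m) * s) (𝓝 0) (𝓝 p) := by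
    have : Continuous fun s : ℝ => p + (1 - m) * s := by fun_prop
    simpa using this.tendsto 0
  have hy : Tendsto (fun s : ℝ => p - m * s) (𝓝 0) (𝓝 p) := by
    have : Continuous fun s : ℝ => p - m * s := by fun_prop
    simpa using this.tendsto 0
  have hxI := hx.eventually_mem (hI.mem_nhds hp)
  have hyI := hy.eventually_mem (hI.mem_nhds hp)
  have hz : Tendsto (fun s => bajraktarevicMean I f g μ (p + (1 - m) * s) (p - m * s))
      (𝓝 0) (𝓝 p) := by
    -- The mean is squeezed between the minimum and maximum of its arguments.
    refine tendsto_of_tendsto_of_tendsto_of_le_of_le' (by simpa using hx.min hy)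
      (by simpa using hx.max hy) ?_ ?_ <;> filter_upwards [hxI, hyI] with s h1 h2
    · exact (bajraktarevicMean_mem_uIcc hIc hfg.chebyshev hg μ h1 h2).1
    · exact (bajraktarevicMean_mem_uIcc hIc hfg.chebyshev hg μ h1 h2).2
  have harg : ∀ s (t : unitInterval), (t : ℝ) * (p + (1 - m) * s) + (1 - (t : ℝ)) * (p - m * s) =
      p + ((t : ℝ) - m) * s := fun s t => by ring
  refine (isLittleO_implicit_sub (hf3.taylor_one_isBigO hI hc hp) (hg3.taylor_one_isBigO hI hc hp)
    (hfg.wronskian_ne_zero (by norm_num) p hp) (isLittleO_integral_sub_moments hI hc hf3 hp μ hm)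
    (isLittleO_integral_sub_moments hI hc hg3 hp μ hm) hz ?_).congr_left fun s => by ring
  filter_upwards [hxI, hyI] with s h1 h2
  obtain ⟨-, hM, hG, heq⟩ := bajraktarevicMean_spec hIc hfg.chebyshev hg μ h1 h2
  rw [div_eq_div_iff (hg _ hM) hG] at heq
  simp only [harg] at heq
  rw [heq, mul_comm]

theorem wronskian_ratios_eq_of_bajraktarevicMean_eventuallyEq {I : Set ℝ} (hI : IsOpen I)
    (hIc : I.OrdConnected) {f g h k : ℝ → ℝ} (hfg : MemClassC 3 I f g) (hhk : MemClassC 3 I h k)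
    (hg : ∀ x ∈ I, g x ≠ 0) (hk : ∀ x ∈ I, k x ≠ 0) (μ : Measure unitInterval)
    [IsProbabilityMeasure μ] (hμ2 : centralMoment (fun t : unitInterval => (t : ℝ)) 2 μ ≠ 0)
    (hμ3 : centralMoment (fun t : unitInterval => (t : ℝ)) 3 μ ≠ 0) {p : ℝ} (hp : p ∈ I)
    (heq : ∀ᶠ q : ℝ × ℝ in 𝓝 (p, p),
      bajraktarevicMean I f g μ q.1 q.2 = bajraktarevicMean I h k μ q.1 q.2) :
    (deriv (deriv f) p * g p - f p * deriv (deriv g) p) / (deriv f p * g p - f p * deriv g p) =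
      (deriv (deriv h) p * k p - h p * deriv (deriv k) p) /
        (deriv h p * k p - h p * deriv k p) ∧
    (deriv (deriv (deriv f)) p * g p - f p * deriv (deriv (deriv g)) p) /
        (deriv f p * g p - f p * deriv g p) =
      (deriv (deriv (deriv h)) p * k p - h p * deriv (deriv (deriv k)) p) /
        (deriv h p * k p - h p * deriv k p) := by
  obtain ⟨m, hm⟩ : ∃ m, m = ∫ r : unitInterval, (r : ℝ) ∂μ := ⟨_, rfl⟩
  have h1 := bajraktarevicMean_sub_isLittleO hI hIc hfg hg μ hp hm
  have h2 := bajraktarevicMean_sub_isLittleO hI hIc hhk hk μ hp hm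
  have hxy : Tendsto (fun s : ℝ => (p + (1 - m) * s, p - m * s)) (𝓝 0) (𝓝 (p, p)) := by
    have : Continuous fun s : ℝ => (p + (1 - m) * s, p - m * s) := by fun_prop
    simpa using this.tendsto 0
  obtain ⟨ha, hb⟩ := eq_zero_of_isLittleO_cube
    (a := centralMoment (fun t : unitInterval => (t : ℝ)) 2 μ / 2 *
      ((deriv (deriv h) p * k p - h p * deriv (deriv k) p) / (deriv h p * k p - h p * deriv k p) -
      (deriv (deriv f) p * g p - f p * deriv (deriv g) p) / (deriv f p * g p - f p * deriv g p)))
    (b := centralMoment (fun t : unitInterval => (t : ℝ)) 3 μ / 6 *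
      ((deriv (deriv (deriv h)) p * k p - h p * deriv (deriv (deriv k)) p) /
        (deriv h p * k p - h p * deriv k p) -
      (deriv (deriv (deriv f)) p * g p - f p * deriv (deriv (deriv g)) p) /
        (deriv f p * g p - f p * deriv g p))) (by
      refine (h1.sub h2).congr' ?_ .rfl
      filter_upwards [hxy.eventually heq] with s hs
      rw [hs]
      ring)
  constructor
  · have := (mul_eq_zero.1 ha).resolve_left (div_ne_zero hμ2 two_ne_zero)
    linarith
  · have := (mul_eq_zero.1 hb).resolve_left (div_ne_zero hμ3 (by norm_num))
    linarith

/-! ### From equal Wronskian ratios to equivalence -/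

theorem ContDiffOn.hasDerivAt_deriv_three {I : Set ℝ} (hI : IsOpen I) {f : ℝ → ℝ}
    (hf : ContDiffOn ℝ 3 f I) :
    (∀ x ∈ I, HasDerivAt f (deriv f x) x) ∧
    (∀ x ∈ I, HasDerivAt (deriv f) (deriv (deriv f) x) x) ∧
    (∀ x ∈ I, HasDerivAt (deriv (deriv f)) (deriv (deriv (deriv f)) x) x) ∧
    ContinuousOn (deriv (deriv (deriv f))) I := by
  have h2 : ContDiffOn ℝ 2 (deriv f) I := hf.deriv_of_isOpen hI (by norm_num)
  have h1 : ContDiffOn ℝ 1 (deriv (deriv f)) I := h2.deriv_of_isOpen hI (by norm_num)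
  have key : ∀ {n : WithTop ℕ∞} {φ : ℝ → ℝ}, n ≠ 0 → ContDiffOn ℝ n φ I →
      ∀ x ∈ I, HasDerivAt φ (deriv φ x) x := fun hn hφ x hx =>
    ((hφ.differentiableOn hn).differentiableAt (hI.mem_nhds hx)).hasDerivAt
  exact ⟨key (by norm_num) hf, key (by norm_num) h2, key (by norm_num) h1,
    h1.continuousOn_deriv_of_isOpen hI (by norm_num)⟩

/-- The quotient of the Wronskians of two pairs of solutions of `u'' = Φ u' + Ψ u` is constant. -/
theorem exists_wronskian_eq_const_mul {I : Set ℝ} (hI : IsOpen I) (hc : IsPreconnected I)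
    {u v h k Φ Ψ : ℝ → ℝ} (hu : ContDiffOn ℝ 3 u I) (hv : ContDiffOn ℝ 3 v I)
    (hh : ContDiffOn ℝ 3 h I) (hk : ContDiffOn ℝ 3 k I)
    (hW : ∀ x ∈ I, deriv h x * k x - h x * deriv k x ≠ 0)
    (hu2 : ∀ x ∈ I, deriv (deriv u) x = Φ x * deriv u x + Ψ x * u x)
    (hv2 : ∀ x ∈ I, deriv (deriv v) x = Φ x * deriv v x + Ψ x * v x)
    (hh2 : ∀ x ∈ I, deriv (deriv h) x = Φ x * deriv h x + Ψ x * h x)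
    (hk2 : ∀ x ∈ I, deriv (deriv k) x = Φ x * deriv k x + Ψ x * k x) :
    ∃ c : ℝ, ∀ x ∈ I, deriv u x * v x - u x * deriv v x =
      c * (deriv h x * k x - h x * deriv k x) := by
  -- Abel's identity: both Wronskians satisfy `w' = Φ w`.
  have hd : ∀ x ∈ I, HasDerivAt (fun x => (deriv u x * v x - u x * deriv v x) /
      (deriv h x * k x - h x * deriv k x)) 0 x := fun x hx => by
    obtain ⟨u1, u2, -⟩ := hu.hasDerivAt_deriv_three hI
    obtain ⟨v1, v2, -⟩ := hv.hasDerivAt_deriv_three hI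
    obtain ⟨h1, h2, -⟩ := hh.hasDerivAt_deriv_three hI
    obtain ⟨k1, k2, -⟩ := hk.hasDerivAt_deriv_three hI
    refine ((((u2 x hx).mul (v1 x hx)).sub ((u1 x hx).mul (v2 x hx))).div
      (((h2 x hx).mul (k1 x hx)).sub ((h1 x hx).mul (k2 x hx))) (hW x hx)).congr_deriv ?_
    rw [div_eq_zero_iff]
    left
    simp only [Pi.sub_apply, Pi.mul_apply]
    rw [hu2 x hx, hv2 x hx, hh2 x hx, hk2 x hx]
    ring
  obtain ⟨c, hcst⟩ := hI.exists_is_const_of_deriv_eq_zero hc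
    (fun x hx => (hd x hx).differentiableAt.differentiableWithinAt) fun x hx => (hd x hx).deriv
  exact ⟨c, fun x hx => (div_eq_iff (hW x hx)).1 (hcst x hx)⟩

theorem equivalentPairs_of_second_order_ode {I : Set ℝ} (hI : IsOpen I) (hc : IsPreconnected I)
    (hne : I.Nonempty) {f g h k Φ Ψ : ℝ → ℝ} (hfg : MemClassC 3 I f g) (hhk : MemClassC 3 I h k)
    (hf2 : ∀ x ∈ I, deriv (deriv f) x = Φ x * deriv f x + Ψ x * f x)
    (hg2 : ∀ x ∈ I, deriv (deriv g) x = Φ x * deriv g x + Ψ x * g x)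
    (hh2 : ∀ x ∈ I, deriv (deriv h) x = Φ x * deriv h x + Ψ x * h x)
    (hk2 : ∀ x ∈ I, deriv (deriv k) x = Φ x * deriv k x + Ψ x * k x) :
    EquivalentPairs I f g h k := by
  have hW := hhk.wronskian_ne_zero (by norm_num)
  have key := fun {u v : ℝ → ℝ} (hu : ContDiffOn ℝ 3 u I) (hv : ContDiffOn ℝ 3 v I) hu2 hv2 =>
    exists_wronskian_eq_const_mul hI hc hu hv hhk.contDiffOn_left hhk.contDiffOn_right hW
      hu2 hv2 hh2 hk2
  obtain ⟨α, hα⟩ := key hfg.contDiffOn_left hhk.contDiffOn_right hf2 hk2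
  obtain ⟨β, hβ⟩ := key hfg.contDiffOn_left hhk.contDiffOn_left hf2 hh2
  obtain ⟨γ, hγ⟩ := key hfg.contDiffOn_right hhk.contDiffOn_right hg2 hk2
  obtain ⟨δ, hδ⟩ := key hfg.contDiffOn_right hhk.contDiffOn_left hg2 hh2
  -- Uses the identity `f W(h,k) = h W(f,k) - k W(f,h)` and its analogue with `f', h', k'` as outer
  -- factors. The derivative relations give `W(f,g) = det * W(h,k)`, hence nonsingularity.
  have hlin : ∀ x ∈ I, (f x = α * h x + -β * k x ∧ g x = γ * h x + -δ * k x) ∧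
      (deriv f x = α * deriv h x + -β * deriv k x ∧
        deriv g x = γ * deriv h x + -δ * deriv k x) := fun x hx => by
    have hα := hα x hx
    have hβ := hβ x hx
    have hγ := hγ x hx
    have hδ := hδ x hx
    refine ⟨⟨?_, ?_⟩, ?_, ?_⟩ <;> refine mul_right_cancel₀ (hW x hx) ?_
    · linear_combination h x * hα - k x * hβ
    · linear_combination h x * hγ - k x * hδ
    · linear_combination deriv h x * hα - deriv k x * hβ
    · linear_combination deriv h x * hγ - deriv k x * hδ
  refine ⟨α, -β, γ, -δ, fun h0 => ?_, fun x hx => (hlin x hx).1⟩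
  obtain ⟨x, hx⟩ := hne
  refine hfg.wronskian_ne_zero (by norm_num) x hx ?_
  obtain ⟨⟨e1, e2⟩, e3, e4⟩ := hlin x hx
  rw [e1, e2, e3, e4]
  linear_combination (deriv h x * k x - h x * deriv k x) * h0

theorem equivalentPairs_of_wronskian_ratios_eq {I : Set ℝ} (hI : IsOpen I)
    (hc : IsPreconnected I) (hne : I.Nonempty) {f g h k : ℝ → ℝ} (hfg : MemClassC 3 I f g)
    (hhk : MemClassC 3 I h k)
    (h2 : ∀ p ∈ I, (deriv (deriv f) p * g p - f p * deriv (deriv g) p) /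
        (deriv f p * g p - f p * deriv g p) =
      (deriv (deriv h) p * k p - h p * deriv (deriv k) p) / (deriv h p * k p - h p * deriv k p))
    (h3 : ∀ p ∈ I, (deriv (deriv (deriv f)) p * g p - f p * deriv (deriv (deriv g)) p) /
        (deriv f p * g p - f p * deriv g p) =
      (deriv (deriv (deriv h)) p * k p - h p * deriv (deriv (deriv k)) p) /
        (deriv h p * k p - h p * deriv k p)) :
    EquivalentPairs I f g h k := by
  have hWf := hfg.wronskian_ne_zero (by norm_num)
  have hWh := hhk.wronskian_ne_zero (by norm_num)
  have hder : ∀ {u v : ℝ → ℝ}, MemClassC 3 I u v → ∀ x ∈ I,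
      HasDerivAt (fun p => (deriv (deriv u) p * v p - u p * deriv (deriv v) p) /
        (deriv u p * v p - u p * deriv v p))
      ((deriv (deriv (deriv u)) x * v x - u x * deriv (deriv (deriv v)) x) /
        (deriv u x * v x - u x * deriv v x) -
        (deriv u x * deriv (deriv v) x - deriv (deriv u) x * deriv v x) /
        (deriv u x * v x - u x * deriv v x) -
        ((deriv (deriv u) x * v x - u x * deriv (deriv v) x) /
        (deriv u x * v x - u x * deriv v x)) ^ 2) x := fun {u v} huv x hx => by
    obtain ⟨u1, u2, u3, -⟩ := huv.contDiffOn_left.hasDerivAt_deriv_three hI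
    obtain ⟨v1, v2, v3, -⟩ := huv.contDiffOn_right.hasDerivAt_deriv_three hI
    have hW := huv.wronskian_ne_zero (by norm_num) x hx
    refine ((((u3 x hx).mul (v1 x hx)).sub ((u1 x hx).mul (v3 x hx))).div
      (((u2 x hx).mul (v1 x hx)).sub ((u1 x hx).mul (v2 x hx))) hW).congr_deriv ?_
    simp only [Pi.sub_apply, Pi.mul_apply]
    field_simp
    ring
  -- In the derivative of `W₂₀/W₁₀`, namely `W₃₀/W₁₀ + W₂₁/W₁₀ - (W₂₀/W₁₀)²`, all terms but the
  -- middle one are already known to agree.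
  have h0 : ∀ p ∈ I, (deriv f p * deriv (deriv g) p - deriv (deriv f) p * deriv g p) /
        (deriv f p * g p - f p * deriv g p) =
      (deriv h p * deriv (deriv k) p - deriv (deriv h) p * deriv k p) /
        (deriv h p * k p - h p * deriv k p) := fun p hp => by
    have := (hder hfg p hp).unique ((hder hhk p hp).congr_of_eventuallyEq
      (eventually_of_mem (hI.mem_nhds hp) h2))
    rw [h2 p hp, h3 p hp] at this
    linarith
  -- Cramer's rule: these are the unique `Φ`, `Ψ` for which `f` and `g` both solve the equation.
  refine equivalentPairs_of_second_order_ode hI hc hne hfg hhk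
    (Φ := fun p => (deriv (deriv f) p * g p - f p * deriv (deriv g) p) /
        (deriv f p * g p - f p * deriv g p))
    (Ψ := fun p => (deriv f p * deriv (deriv g) p - deriv (deriv f) p * deriv g p) /
        (deriv f p * g p - f p * deriv g p)) ?_ ?_ ?_ ?_ <;> intro x hx
  on_goal 3 => rw [h2 x hx, h0 x hx]
  on_goal 4 => rw [h2 x hx, h0 x hx]
  all_goals
    rw [div_mul_eq_mul_div, div_mul_eq_mul_div, ← add_div,
      eq_div_iff (by first | exact hWf x hx | exact hWh x hx)]
    ring

/-! ### Invariance under equivalence, and the theorem -/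

theorem bajraktarevicMean_eq_of_equivalentPairs {I : Set ℝ} (hI : I.OrdConnected)
    {f g h k : ℝ → ℝ} (hfg : IsChebyshevSystem I f g) (hhk : IsChebyshevSystem I h k)
    (hg : ∀ x ∈ I, g x ≠ 0) (hk : ∀ x ∈ I, k x ≠ 0) (μ : Measure unitInterval)
    [IsProbabilityMeasure μ] (he : EquivalentPairs I f g h k) {x y : ℝ} (hx : x ∈ I)
    (hy : y ∈ I) : bajraktarevicMean I f g μ x y = bajraktarevicMean I h k μ x y := by
  obtain ⟨α, β, γ, δ, -, he⟩ := he
  obtain ⟨hinj, hM, hG, heq⟩ := bajraktarevicMean_spec hI hfg hg μ hx hy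
  obtain ⟨-, hN, hK, heq'⟩ := bajraktarevicMean_spec hI hhk hk μ hx hy
  -- It suffices that the `(h, k)`-mean also solves the equation defining the `(f, g)`-mean.
  refine hinj hM hN (heq.trans ?_)
  have hm : ∀ t : unitInterval, (t : ℝ) * x + (1 - (t : ℝ)) * y ∈ I := fun t =>
    hI.convex hx hy t.2.1 (sub_nonneg.2 t.2.2) (by ring)
  have hc : Continuous fun t : unitInterval => (t : ℝ) * x + (1 - (t : ℝ)) * y := by fun_prop
  have hint : ∀ φ : ℝ → ℝ, ContinuousOn φ I →
      Integrable (fun t : unitInterval => φ ((t : ℝ) * x + (1 - (t : ℝ)) * y)) μ := fun φ hφ =>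
    (hφ.comp_continuous hc hm).integrable_of_hasCompactSupport
      (HasCompactSupport.of_compactSpace _)
  have hcomb : ∀ (φ : ℝ → ℝ) (a b : ℝ), (∀ z ∈ I, φ z = a * h z + b * k z) →
      ∫ t : unitInterval, φ ((t : ℝ) * x + (1 - (t : ℝ)) * y) ∂μ =
        a * (∫ t : unitInterval, h ((t : ℝ) * x + (1 - (t : ℝ)) * y) ∂μ) +
        b * ∫ t : unitInterval, k ((t : ℝ) * x + (1 - (t : ℝ)) * y) ∂μ := fun φ a b hφ => by
    simp_rw [fun t : unitInterval => hφ _ (hm t)]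
    rw [integral_add ((hint h hhk.continuousOn_left).const_mul a)
      ((hint k hhk.continuousOn_right).const_mul b), integral_const_mul, integral_const_mul]
  have hF := hcomb f α β fun z hz => (he z hz).1
  have hG' := hcomb g γ δ fun z hz => (he z hz).2
  dsimp only
  rw [div_eq_div_iff hG (hg _ hN), hF, hG', (he _ hN).1, (he _ hN).2]
  rw [div_eq_div_iff (hk _ hN) hK] at heq'
  linear_combination (β * γ - α * δ) * heq'

theorem mainTheorem8 (I : Set ℝ) (hI_open : IsOpen I) (hI_interval : I.OrdConnected)
    (hI_nonempty : I.Nonempty) (f g h k : ℝ → ℝ)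
    (hfg : MemClassC 3 I f g) (hhk : MemClassC 3 I h k)
    (hg : ∀ x ∈ I, g x ≠ 0) (hk : ∀ x ∈ I, k x ≠ 0)
    (μ : Measure unitInterval) [IsProbabilityMeasure μ]
    (hμ2 : centralMoment (fun t : unitInterval => (t : ℝ)) 2 μ ≠ 0) (hμ3 : centralMoment (fun t : unitInterval => (t : ℝ)) 3 μ ≠ 0) :
    List.TFAE [
      ∀ x ∈ I, ∀ y ∈ I, bajraktarevicMean I f g μ x y = bajraktarevicMean I h k μ x y,
      ∃ D : Set ℝ, D ⊆ I ∧ I ⊆ closure D ∧ ∃ U : Set (ℝ × ℝ), IsOpen U ∧ U ⊆ I ×ˢ I ∧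
        (∀ x ∈ D, (x, x) ∈ U) ∧
        ∀ x y : ℝ, (x, y) ∈ U → bajraktarevicMean I f g μ x y = bajraktarevicMean I h k μ x y,
      EquivalentPairs I f g h k] := by
  tfae_have 1 → 2 := fun H => ⟨I, Subset.rfl, subset_closure, I ×ˢ I, hI_open.prod hI_open,
    Subset.rfl, fun x hx => ⟨hx, hx⟩, fun x y hxy => H x hxy.1 y hxy.2⟩
  tfae_have 2 → 3 := by
    rintro ⟨D, hDI, hD, U, hU, -, hDU, heq⟩
    have hD' := fun p hp => wronskian_ratios_eq_of_bajraktarevicMean_eventuallyEq hI_open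
      hI_interval hfg hhk hg hk μ hμ2 hμ3 (hDI hp)
      (eventually_of_mem (hU.mem_nhds (hDU p hp)) fun q hq => heq q.1 q.2 hq)
    obtain ⟨f1, f2, f3, f3c⟩ := hfg.contDiffOn_left.hasDerivAt_deriv_three hI_open
    obtain ⟨g1, g2, g3, g3c⟩ := hfg.contDiffOn_right.hasDerivAt_deriv_three hI_open
    obtain ⟨h1, h2, h3, h3c⟩ := hhk.contDiffOn_left.hasDerivAt_deriv_three hI_open
    obtain ⟨k1, k2, k3, k3c⟩ := hhk.contDiffOn_right.hasDerivAt_deriv_three hI_open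
    have hcont : ∀ {φ φ' : ℝ → ℝ}, (∀ x ∈ I, HasDerivAt φ (φ' x) x) → ContinuousOn φ I :=
      fun H x hx => (H x hx).continuousAt.continuousWithinAt
    have hWf := hfg.wronskian_ne_zero (by norm_num)
    have hWh := hhk.wronskian_ne_zero (by norm_num)
    have hcW : ∀ {a b c d e j : ℝ → ℝ}, ContinuousOn a I → ContinuousOn b I → ContinuousOn c I →
        ContinuousOn d I → ContinuousOn e I → ContinuousOn j I →
        (∀ x ∈ I, e x * b x - c x * j x ≠ 0) →
        ContinuousOn (fun x => (a x * b x - c x * d x) / (e x * b x - c x * j x)) I :=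
      fun ha hb hc hd he hj h0 =>
        ((ha.mul hb).sub (hc.mul hd)).div ((he.mul hb).sub (hc.mul hj)) h0
    refine equivalentPairs_of_wronskian_ratios_eq hI_open hI_interval.isPreconnected hI_nonempty
      hfg hhk ?_ ?_
    -- Both ratios are continuous because the functions are `C³` and the Wronskians do not vanish,
    -- so equality on `D` spreads to `I`.
    · exact Set.EqOn.of_subset_closure (fun p hp => (hD' p hp).1)
        (hcW (hcont f3) (hcont g1) (hcont f1) (hcont g3) (hcont f2) (hcont g2) hWf)
        (hcW (hcont h3) (hcont k1) (hcont h1) (hcont k3) (hcont h2) (hcont k2) hWh) hDI hD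
    · exact Set.EqOn.of_subset_closure (fun p hp => (hD' p hp).2)
        (hcW f3c (hcont g1) (hcont f1) g3c (hcont f2) (hcont g2) hWf)
        (hcW h3c (hcont k1) (hcont h1) k3c (hcont h2) (hcont k2) hWh) hDI hD
  tfae_have 3 → 1 := fun H x hx y hy => bajraktarevicMean_eq_of_equivalentPairs hI_interval
    hfg.chebyshev hhk.chebyshev hg hk μ H hx hy
  tfae_finish
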